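/- All digraphs are finite. An oriented tree (respectively, oriented path) is a digraph without loops and without pairs of opposite arcs whose underlying undirected graph is a tree (respectively, a path with $n+1$ vertices for some $n\ge 0$). For digraphs $G,H$ write $G\to H$ if there is a homomorphism from $G$ to $H$, that is, a map of the vertices which sends arcs to arcs, and write $G<H$ if $G\to H$ but $H\not\to G$. Let $\vec P_k$ denote the directed path with vertices $0,1,\dots,k$ and arcs $(0,1),(1,2),\dots,(k-1,k)$. The height of an oriented path $P$ is the minimum $k\ge 0$ such that $P\to\vec P_k$. Theorem. Let $T_1$ be an oriented tree and let $P_2$ be an oriented path such that $T_1<P_2$. If the height of $P_2$ is greater than or equal to $4$, then there exists an oriented tree $T$ satisfying $T_1<T<P_2$. -/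

import Mathlib

namespace OrientedTrees

/-- A digraph is an oriented graph if it has no loops and no two opposite arcs. -/
def IsOriented {V : Type*} (G : Digraph V) : Prop :=
  ∀ u v : V, G.Adj u v → ¬ G.Adj v u

/-- A finite oriented graph is an oriented tree if its underlying undirected graph is a tree. -/
def IsOrientedTree {V : Type*} (G : Digraph V) : Prop :=
  Finite V ∧ IsOriented G ∧ G.toSimpleGraphInclusive.IsTree

/-- An oriented graph is an oriented path if its vertices can be listed without repetition as
`p 0, …, p n`, for some `n ≥ 0`, so that the underlying undirected graph is the path
`p 0, …, p n`; each edge is then oriented in exactly one of the two directions. -/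
def IsOrientedPath {V : Type*} (G : Digraph V) : Prop :=
  IsOriented G ∧
    ∃ n : ℕ, Nonempty (SimpleGraph.pathGraph (n + 1) ≃g G.toSimpleGraphInclusive)

/-- There is a homomorphism (an arc preserving map of vertices) from `G` to `H`. -/
def HomLE {V W : Type*} (G : Digraph V) (H : Digraph W) : Prop :=
  Nonempty (G.Adj →r H.Adj)

/-- The strict homomorphism order. -/
def HomLT {V W : Type*} (G : Digraph V) (H : Digraph W) : Prop :=
  HomLE G H ∧ ¬ HomLE H G

/-- The directed path with vertices `0, …, n` and arcs `(0,1), …, (n-1,n)`. -/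
def directedPath (n : ℕ) : Digraph (Fin (n + 1)) where
  Adj i j := (i : ℕ) + 1 = (j : ℕ)

/-- The height of an oriented path: the least `k` such that the path has a homomorphism to the
directed path with `k` arcs. -/
noncomputable def height {V : Type*} (G : Digraph V) : ℕ :=
  sInf {k : ℕ | HomLE G (directedPath k)}

end OrientedTrees

namespace OrientedTrees

open SimpleGraph

universe u v

/-! Replace `P₂` by a shortest equivalent oriented path, given by a word `w` of length `n`; it is a
core. All trees are built with a projection to this path, so lying below `P₂` is automatic, and
lying strictly below means containing no image of the core.

Height at least 4 yields a vertex `v`, at least two steps from both ends, where the path goes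
straight on (`exists_straight_vertex`). Extend `T₁` to reach the fibre of `v`, then attach zigzags:
from a vertex over `v` one step to one side, back to a new vertex over `v`, and from there to the
end of the path on that side. Because `v` is far from the ends, no section of the projection can
enter a zigzag, so no image of the core arises (`not_traces_attach_turn`).

Zigzags to alternating sides give vertices over `v`, consecutive ones carrying complementary halves
of the core. A homomorphism to `T₁` must separate consecutive ones, since otherwise the two halves
glue to an image of the core in `T₁`. It cannot fold at these vertices either: as `v` is straight,
the arcs towards its two sides have opposite orientations. A walk without folding in a tree is a
path, so enough zigzags exceed the size of `T₁` (`exists_growth`, `exists_tree_not_homLE`). -/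

/-- `Arc G d x y` says that there is an arc from `x` to `y` if `d` is true, and one from `y` to `x`
otherwise. -/
def Arc {V : Type*} (G : Digraph V) (d : Bool) (x y : V) : Prop :=
  if d then G.Adj x y else G.Adj y x

theorem arc_not_iff {V : Type*} {G : Digraph V} {d : Bool} {x y : V} :
    Arc G (!d) x y ↔ Arc G d y x := by
  cases d <;> simp [Arc]

theorem Arc.map {V W : Type*} {G : Digraph V} {H : Digraph W} {d : Bool} {x y : V}
    (g : G.Adj →r H.Adj) (h : Arc G d x y) : Arc H d (g x) (g y) := by
  cases d
  · exact g.map_rel (show G.Adj y x from h)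
  · exact g.map_rel (show G.Adj x y from h)

theorem IsOriented.not_arc {V : Type*} {G : Digraph V} (hG : IsOriented G) {d : Bool} {x y : V}
    (h : Arc G d x y) : ¬ Arc G d y x := by
  cases d
  · exact hG y x h
  · exact hG x y h

theorem IsOriented.inclusive_adj {V : Type*} {G : Digraph V} (hG : IsOriented G) {x y : V} :
    G.toSimpleGraphInclusive.Adj x y ↔ G.Adj x y ∨ G.Adj y x := by
  constructor
  · exact fun h => h.2
  · refine fun h => ⟨?_, h⟩
    rintro rfl
    exact hG x x (or_self_iff.mp h) (or_self_iff.mp h)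

theorem Arc.inclusive_adj {V : Type*} {G : Digraph V} (hG : IsOriented G) {d : Bool} {x y : V}
    (h : Arc G d x y) : G.toSimpleGraphInclusive.Adj x y := by
  rw [hG.inclusive_adj]
  cases d
  · exact Or.inr h
  · exact Or.inl h

/-! ### Attaching a pendant path to a tree over an oriented graph -/

/-- The `j`-th vertex of a pendant path of length `ℓ` attached at the vertex `u`. -/
def pendant {V : Type*} (u : V) (ℓ : ℕ) : ℕ → V ⊕ Fin ℓ
  | 0 => Sum.inl u
  | j + 1 => if h : j < ℓ then Sum.inr ⟨j, h⟩ else Sum.inl u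

/-- The distance from the base digraph after attaching a pendant path. -/
def level {V : Type*} {ℓ : ℕ} : V ⊕ Fin ℓ → ℕ :=
  Sum.elim (fun _ => 0) (fun j => j + 1)

theorem pendant_succ {V : Type*} (u : V) {ℓ j : ℕ} (h : j < ℓ) :
    pendant u ℓ (j + 1) = Sum.inr ⟨j, h⟩ := by
  simp [pendant, h]

theorem level_pendant {V : Type*} (u : V) {ℓ j : ℕ} (h : j ≤ ℓ) : level (pendant u ℓ j) = j := by
  cases j with
  | zero => rfl
  | succ j => rw [pendant_succ u h]; rfl

/-- The digraph obtained from `S` by attaching, at the vertex `u`, a pendant path with `ℓ` arcs whose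
`j`-th vertex lies over the vertex `σ j` of `H`. -/
def attach {V X : Type*} (S : Digraph V) (u : V) (H : Digraph X) (σ : ℕ → X) (ℓ : ℕ) :
    Digraph (V ⊕ Fin ℓ) where
  Adj x y := (∃ a b, x = Sum.inl a ∧ y = Sum.inl b ∧ S.Adj a b) ∨
    ∃ j < ℓ, (x = pendant u ℓ j ∧ y = pendant u ℓ (j + 1) ∧ H.Adj (σ j) (σ (j + 1))) ∨
      (x = pendant u ℓ (j + 1) ∧ y = pendant u ℓ j ∧ H.Adj (σ (j + 1)) (σ j))

/-- The projection of a digraph with an attached pendant path. -/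
def proj {V X : Type*} (f : V → X) (σ : ℕ → X) (ℓ : ℕ) : V ⊕ Fin ℓ → X :=
  Sum.elim f (fun j => σ (j + 1))

theorem proj_pendant {V X : Type*} {f : V → X} {σ : ℕ → X} {u : V} {ℓ j : ℕ} (h0 : σ 0 = f u)
    (h : j ≤ ℓ) : proj f σ ℓ (pendant u ℓ j) = σ j := by
  cases j with
  | zero => exact h0.symm
  | succ j => rw [pendant_succ u h]; rfl

section attach

variable {V : Type u} {X : Type v} {S : Digraph V} {u : V} {H : Digraph X} {σ : ℕ → X} {ℓ : ℕ}

theorem attach_adj_cases {x y : V ⊕ Fin ℓ}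
    (h : (attach S u H σ ℓ).Adj x y ∨ (attach S u H σ ℓ).Adj y x) :
    (∃ a b, x = Sum.inl a ∧ y = Sum.inl b ∧ (S.Adj a b ∨ S.Adj b a)) ∨
    ∃ j < ℓ, (x = pendant u ℓ j ∧ y = pendant u ℓ (j + 1)) ∨
      (x = pendant u ℓ (j + 1) ∧ y = pendant u ℓ j) := by
  rcases h with (⟨a, b, rfl, rfl, h⟩ | ⟨j, hj, ⟨hx, hy, -⟩ | ⟨hx, hy, -⟩⟩) |
    (⟨a, b, rfl, rfl, h⟩ | ⟨j, hj, ⟨hx, hy, -⟩ | ⟨hx, hy, -⟩⟩)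
  · exact Or.inl ⟨a, b, rfl, rfl, Or.inl h⟩
  · exact Or.inr ⟨j, hj, Or.inl ⟨hx, hy⟩⟩
  · exact Or.inr ⟨j, hj, Or.inr ⟨hx, hy⟩⟩
  · exact Or.inl ⟨b, a, rfl, rfl, Or.inr h⟩
  · exact Or.inr ⟨j, hj, Or.inr ⟨hy, hx⟩⟩
  · exact Or.inr ⟨j, hj, Or.inl ⟨hy, hx⟩⟩

/-- The inclusion of the base digraph. -/
def attachInl : S.Adj →r (attach S u H σ ℓ).Adj :=
  ⟨Sum.inl, fun h => Or.inl ⟨_, _, rfl, rfl, h⟩⟩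

/-- The projection of an attached digraph as a homomorphism. -/
def attachProj (f : S.Adj →r H.Adj) (h0 : σ 0 = f u) : (attach S u H σ ℓ).Adj →r H.Adj :=
  ⟨proj f σ ℓ, by
    rintro x y (⟨a, b, rfl, rfl, h⟩ | ⟨j, hj, ⟨rfl, rfl, h⟩ | ⟨rfl, rfl, h⟩⟩)
    · exact f.map_rel h
    · rwa [proj_pendant h0 hj.le, proj_pendant h0 hj]
    · rwa [proj_pendant h0 hj.le, proj_pendant h0 hj]⟩

theorem attach_arc {j : ℕ} (hj : j < ℓ) {d : Bool} (h : Arc H d (σ j) (σ (j + 1))) :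
    Arc (attach S u H σ ℓ) d (pendant u ℓ j) (pendant u ℓ (j + 1)) := by
  cases d
  · exact Or.inr ⟨j, hj, Or.inr ⟨rfl, rfl, h⟩⟩
  · exact Or.inr ⟨j, hj, Or.inl ⟨rfl, rfl, h⟩⟩

theorem attach_isOriented (hH : IsOriented H) (f : S.Adj →r H.Adj) (h0 : σ 0 = f u) :
    IsOriented (attach S u H σ ℓ) :=
  fun _ _ h h' => hH _ _ ((attachProj f h0).map_rel h) ((attachProj f h0).map_rel h')

theorem reachable_of_adj_reachable {V W : Type*} {G : SimpleGraph V} {G' : SimpleGraph W}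
    (r : V → W) (hr : ∀ x y, G.Adj x y → G'.Reachable (r x) (r y)) {x y : V}
    (h : G.Reachable x y) : G'.Reachable (r x) (r y) := by
  obtain ⟨p⟩ := h
  induction p with
  | nil => exact Reachable.rfl
  | cons h _ ih => exact (hr _ _ h).trans ih

theorem reachable_invariant {V : Type*} {G : SimpleGraph V} {C : V → Prop}
    (hC : ∀ x y, G.Adj x y → C x → C y) {x y : V} (h : G.Reachable x y) : C x → C y := by
  obtain ⟨p⟩ := h
  induction p with
  | nil => exact id
  | cons h _ ih => exact fun hx => ih (hC _ _ h hx)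

/-- Every edge is a bridge: a pendant edge is the only link between lower and higher levels, and for
a base edge, collapsing the pendant path to `u` turns any detour into a detour in `S`. -/
theorem attach_isOrientedTree (hS : IsOrientedTree S) (hH : IsOriented H) (f : S.Adj →r H.Adj)
    (h0 : σ 0 = f u) (hσ : ∀ j < ℓ, H.Adj (σ j) (σ (j + 1)) ∨ H.Adj (σ (j + 1)) (σ j)) :
    IsOrientedTree (attach S u H σ ℓ) := by
  obtain ⟨hfin, hor, htree⟩ := hS
  have hA := attach_isOriented (ℓ := ℓ) hH f h0
  refine ⟨inferInstance, hA, ?_, ?_⟩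
  · have hstep : ∀ j < ℓ, (attach S u H σ ℓ).toSimpleGraphInclusive.Adj
        (pendant u ℓ j) (pendant u ℓ (j + 1)) := fun j hj => by
      rcases hσ j hj with h | h
      · exact (attach_arc (d := true) hj h).inclusive_adj hA
      · exact (attach_arc (d := false) hj h).inclusive_adj hA
    have hpend : ∀ j ≤ ℓ, (attach S u H σ ℓ).toSimpleGraphInclusive.Reachable
        (Sum.inl u) (pendant u ℓ j) := by
      intro j
      induction j with
      | zero => exact fun _ => Reachable.rfl
      | succ j ih => exact fun hj => (ih (by omega)).trans (hstep j hj).reachable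
    have hall : ∀ x, (attach S u H σ ℓ).toSimpleGraphInclusive.Reachable (Sum.inl u) x := by
      rintro (a | j)
      · refine reachable_of_adj_reachable (G := S.toSimpleGraphInclusive) Sum.inl ?_
          (htree.connected.preconnected u a)
        intro x y hxy
        refine SimpleGraph.Adj.reachable ?_
        rw [hor.inclusive_adj] at hxy
        rw [hA.inclusive_adj]
        exact hxy.imp (attachInl (S := S)).map_rel (attachInl (S := S)).map_rel
      · rw [← pendant_succ u j.2]
        exact hpend _ j.2
    have : Nonempty (V ⊕ Fin ℓ) := ⟨Sum.inl u⟩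
    exact ⟨fun x y => (hall x).symm.trans (hall y)⟩
  · rw [isAcyclic_iff_forall_adj_isBridge]
    have hcut : ∀ j < ℓ, ¬ ((attach S u H σ ℓ).toSimpleGraphInclusive.deleteEdges
        {s(pendant u ℓ j, pendant u ℓ (j + 1))}).Reachable
          (pendant u ℓ j) (pendant u ℓ (j + 1)) := by
      intro j hj h
      have := reachable_invariant (C := fun x => level x ≤ j) ?_ h
        (level_pendant u hj.le).le
      · rw [level_pendant u hj] at this
        omega
      · intro x y hxy hx
        rw [deleteEdges_adj, hA.inclusive_adj] at hxy
        rcases attach_adj_cases hxy.1 with ⟨a, b, rfl, rfl, -⟩ | ⟨i, hi, ⟨rfl, rfl⟩ | ⟨rfl, rfl⟩⟩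
        · exact Nat.zero_le _
        · rw [level_pendant u hi.le] at hx
          rw [level_pendant u hi]
          have : i ≠ j := by
            rintro rfl
            exact hxy.2 rfl
          omega
        · rw [level_pendant u hi] at hx
          rw [level_pendant u hi.le]
          omega
    intro x y hxy
    rw [hA.inclusive_adj] at hxy
    rcases attach_adj_cases hxy with ⟨a, b, rfl, rfl, hab⟩ | ⟨j, hj, ⟨rfl, rfl⟩ | ⟨rfl, rfl⟩⟩
    · intro h
      have hbr := isAcyclic_iff_forall_adj_isBridge.mp htree.isAcyclic (hor.inclusive_adj.mpr hab)
      refine hbr (reachable_of_adj_reachable (Sum.elim id fun _ => u) ?_ h)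
      intro x y hxy
      rw [deleteEdges_adj, hA.inclusive_adj] at hxy
      rcases attach_adj_cases hxy.1 with ⟨c, d, rfl, rfl, hcd⟩ | ⟨i, hi, h⟩
      · refine SimpleGraph.Adj.reachable ?_
        rw [deleteEdges_adj, hor.inclusive_adj]
        refine ⟨hcd, fun h => hxy.2 ?_⟩
        simpa using h
      · have hu : ∀ k ≤ ℓ, Sum.elim id (fun _ => u) (pendant u ℓ k) = u := by
          rintro (_ | k) hk
          · rfl
          · rw [pendant_succ u hk]; rfl
        rcases h with ⟨rfl, rfl⟩ | ⟨rfl, rfl⟩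
        · rw [hu _ hi, hu _ hi.le]
        · rw [hu _ hi, hu _ hi.le]
    · exact hcut j hj
    · intro h
      rw [Sym2.eq_swap] at h
      exact hcut j hj h.symm

end attach

/-! ### Words, their images in digraphs, and core words -/

/-- The infinite oriented path with vertices `0, 1, …` whose `i`-th edge points forwards when `w i`
is true, and backwards otherwise. -/
def wordDigraph (w : ℕ → Bool) : Digraph ℕ where
  Adj i j := (j = i + 1 ∧ w i = true) ∨ (i = j + 1 ∧ w j = false)

/-- `Traces G w a b p` says that `p` maps the segment of `wordDigraph w` between `a` and `b`
homomorphically to `G`. -/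
def Traces {V : Type*} (G : Digraph V) (w : ℕ → Bool) (a b : ℕ) (p : ℕ → V) : Prop :=
  ∀ i, a ≤ i → i < b → Arc G (w i) (p i) (p (i + 1))

/-- Every endomorphism of the initial segment of length `n` of `wordDigraph w` is surjective. -/
def IsCoreWord (w : ℕ → Bool) (n : ℕ) : Prop :=
  ∀ φ : ℕ → ℕ, (∀ i ≤ n, φ i ≤ n) → Traces (wordDigraph w) w 0 n φ → ∀ j ≤ n, ∃ i ≤ n, φ i = j

theorem wordDigraph_isOriented (w : ℕ → Bool) : IsOriented (wordDigraph w) := by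
  rintro i j (⟨h, h'⟩ | ⟨h, h'⟩) (⟨k, k'⟩ | ⟨k, k'⟩)
  · omega
  · rw [h'] at k'
    cases k'
  · rw [h'] at k'
    cases k'
  · omega

theorem wordDigraph_arc (w : ℕ → Bool) (i : ℕ) : Arc (wordDigraph w) (w i) i (i + 1) := by
  cases h : w i
  · exact Or.inr ⟨rfl, h⟩
  · exact Or.inl ⟨rfl, h⟩

theorem Arc.wordDigraph_consecutive {w : ℕ → Bool} {d : Bool} {i j : ℕ}
    (h : Arc (wordDigraph w) d i j) : j = i + 1 ∨ i = j + 1 := by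
  cases d
  · exact (show (wordDigraph w).Adj j i from h).symm.imp (·.1) (·.1)
  · exact (show (wordDigraph w).Adj i j from h).imp (·.1) (·.1)

theorem wordDigraph_adj_or {w : ℕ → Bool} {i j : ℕ} (h : j = i + 1 ∨ i = j + 1) :
    (wordDigraph w).Adj i j ∨ (wordDigraph w).Adj j i := by
  rcases h with rfl | rfl
  · have := wordDigraph_arc w i
    cases h : w i <;> rw [h] at this
    · exact Or.inr this
    · exact Or.inl this
  · have := wordDigraph_arc w j
    cases h : w j <;> rw [h] at this
    · exact Or.inl this
    · exact Or.inr this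

theorem Traces.map {V W : Type*} {G : Digraph V} {H : Digraph W} {w : ℕ → Bool} {a b : ℕ}
    {p : ℕ → V} (h : Traces G w a b p) (g : G.Adj →r H.Adj) : Traces H w a b (fun i => g (p i)) :=
  fun i hi hi' => (h i hi hi').map g

theorem Traces.adj {V : Type*} {G : Digraph V} {w : ℕ → Bool} {n : ℕ} {p : ℕ → V}
    (h : Traces G w 0 n p) {i j : ℕ} (hi : i ≤ n) (hj : j ≤ n) (hij : (wordDigraph w).Adj i j) :
    G.Adj (p i) (p j) := by
  rcases hij with ⟨rfl, hw⟩ | ⟨rfl, hw⟩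
  · have := h i (Nat.zero_le _) hj
    rwa [hw] at this
  · have := h j (Nat.zero_le _) hi
    rwa [hw] at this

theorem Traces.comp {V : Type*} {G : Digraph V} {w w' : ℕ → Bool} {a b n : ℕ} {p : ℕ → V}
    (h : Traces G w 0 n p) {φ : ℕ → ℕ} (hφ : Traces (wordDigraph w) w' a b φ)
    (hle : ∀ i, a ≤ i → i ≤ b → φ i ≤ n) : Traces G w' a b (fun i => p (φ i)) := by
  intro i hi hi'
  have key := hφ i hi hi'
  have h1 := hle i hi hi'.le
  have h2 := hle (i + 1) (by omega) hi'
  cases hw : w' i <;> rw [hw] at key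
  · exact h.adj h2 h1 key
  · exact h.adj h1 h2 key

theorem traces_wordDigraph (w : ℕ → Bool) (a b : ℕ) : Traces (wordDigraph w) w a b id :=
  fun i _ _ => wordDigraph_arc w i

/-- The endomorphism `f ∘ h` of the core is a permutation of finite order `k + 1`; precomposing `h`
with its `k`-th iterate, the inverse, yields a section of `f`. -/
theorem IsCoreWord.exists_section {w : ℕ → Bool} {n : ℕ} (hcore : IsCoreWord w n) {V : Type*}
    {T : Digraph V} (f : T.Adj →r (wordDigraph w).Adj) (hf : ∀ x, f x ≤ n) {h : ℕ → V}
    (hh : Traces T w 0 n h) : ∃ h', Traces T w 0 n h' ∧ ∀ i ≤ n, f (h' i) = i := by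
  have hφ := hh.map f
  set φ : ℕ → ℕ := fun i => f (h i) with hφdef
  have hle : ∀ i, φ i ≤ n := fun i => hf _
  have hsurj := hcore φ (fun i _ => hle i) hφ
  let F : Fin (n + 1) → Fin (n + 1) := fun i => ⟨φ i, Nat.lt_succ_of_le (hle i)⟩
  have hF : Function.Surjective F := fun j => by
    obtain ⟨i, hi, hij⟩ := hsurj j (Nat.le_of_lt_succ j.2)
    exact ⟨⟨i, Nat.lt_succ_of_le hi⟩, Fin.ext hij⟩
  let e : Equiv.Perm (Fin (n + 1)) :=
    Equiv.ofBijective F ⟨Finite.injective_iff_surjective.mpr hF, hF⟩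
  have hpow : ∀ k (i : Fin (n + 1)), ((e ^ k) i : ℕ) = φ^[k] i := by
    intro k
    induction k with
    | zero => exact fun i => rfl
    | succ k ih =>
      intro i
      rw [pow_succ', Equiv.Perm.mul_apply, Function.iterate_succ_apply', ← ih]
      rfl
  have htr : ∀ k, Traces (wordDigraph w) w 0 n φ^[k] ∧ ∀ i ≤ n, φ^[k] i ≤ n := by
    intro k
    induction k with
    | zero => exact ⟨traces_wordDigraph w 0 n, fun i hi => hi⟩
    | succ k ih =>
      have hk : φ^[k + 1] = fun i => φ (φ^[k] i) := by
        funext i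
        exact Function.iterate_succ_apply' φ k i
      rw [hk]
      exact ⟨hφ.comp ih.1 fun i _ hi => ih.2 i hi, fun i _ => hle _⟩
  have hpos : 0 < orderOf e := orderOf_pos e
  obtain ⟨k, hk⟩ : ∃ k, orderOf e = k + 1 := ⟨orderOf e - 1, by omega⟩
  refine ⟨fun i => h (φ^[k] i), hh.comp (htr k).1 fun i _ hi => (htr k).2 i hi, fun i hi => ?_⟩
  have h1 := hpow (k + 1) ⟨i, Nat.lt_succ_of_le hi⟩
  rw [← hk, pow_orderOf_eq_one, hk, Function.iterate_succ_apply'] at h1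
  exact h1.symm

/-! ### Zigzags do not create an image of the core -/

/-- The walk in the natural numbers which goes from `v` to its successor (if `s` is true) or
predecessor (otherwise), back to `v`, and then straight on in the same direction. -/
def turn (s : Bool) (v j : ℕ) : ℕ :=
  if s then v + (if j = 1 then 1 else j - 2) else v - (if j = 1 then 1 else j - 2)

/-- The length of the walk `turn s v` when it stops at the end of the segment from `0` to `n`. -/
def turnLength (s : Bool) (n v : ℕ) : ℕ :=
  if s then n - v + 2 else v + 2

/-- Here `L i` is the level of a section at `i`. For `s = true` the walk never goes below `v`, so
the section is in the base at `v - 1`; over `v` the only pendant level is 2, not adjacent to the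
base. Level 1 over `v + 1` is a dead end, since both its neighbours lie over `v` and none over `v +
2`. The pendant path is thus never entered. The case `s = false` is the mirror image and uses `v -
2`. -/
theorem level_eq_zero_of_section {s : Bool} {n v : ℕ} (h2 : 2 ≤ v) (hn : v + 2 ≤ n) {L : ℕ → ℕ}
    (hL : ∀ i ≤ n, L i = 0 ∨ i = turn s v (L i))
    (hstep : ∀ i < n, (L i = 0 ∧ L (i + 1) = 0) ∨
      ((L i = 0 → i = v) ∧ (L (i + 1) = 0 → i + 1 = v) ∧
        (L (i + 1) = L i + 1 ∨ L i = L (i + 1) + 1))) :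
    ∀ i ≤ n, L i = 0 := by
  cases s
  · simp only [turn, Bool.false_eq_true, if_false] at hL
    have hv : L v = 0 := by
      have a := hL v (by omega)
      have b := hL (v + 1) (by omega)
      have c := hstep v (by omega)
      split_ifs at a b <;> omega
    have hv' : L (v - 1) = 0 := by
      have a := hL (v - 1) (by omega)
      have b := hL (v - 2) (by omega)
      have c := hstep (v - 1) (by omega)
      have d := hstep (v - 2) (by omega)
      rw [show v - 1 + 1 = v by omega] at c
      rw [show v - 2 + 1 = v - 1 by omega] at d
      split_ifs at a b <;> omega
    have hup : ∀ k, v + k ≤ n → L (v + k) = 0 := by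
      intro k
      induction k with
      | zero => exact fun _ => hv
      | succ k ih =>
        intro hk
        have ih := ih (by omega)
        have a := hL (v + k + 1) (by omega)
        have c := hstep (v + k) (by omega)
        rw [← Nat.add_assoc]
        split_ifs at a <;> omega
    have hdown : ∀ k, k + 1 ≤ v → L (v - (k + 1)) = 0 := by
      intro k
      induction k with
      | zero => exact fun _ => hv'
      | succ k ih =>
        intro hk
        have ih := ih (by omega)
        have c := hstep (v - (k + 1 + 1)) (by omega)
        rw [show v - (k + 1 + 1) + 1 = v - (k + 1) by omega] at c
        omega
    intro i hi
    rcases Nat.lt_or_ge i v with h | h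
    · have := hdown (v - i - 1) (by omega)
      rwa [show v - (v - i - 1 + 1) = i by omega] at this
    · have := hup (i - v) (by omega)
      rwa [show v + (i - v) = i by omega] at this
  · simp only [turn, if_true] at hL
    have hv : L v = 0 := by
      have a := hL v (by omega)
      have b := hL (v - 1) (by omega)
      have c := hstep (v - 1) (by omega)
      rw [show v - 1 + 1 = v by omega] at c
      split_ifs at a b <;> omega
    have hv' : L (v + 1) = 0 := by
      have a := hL (v + 1) (by omega)
      have b := hL (v + 1 + 1) (by omega)
      have c := hstep v (by omega)
      have d := hstep (v + 1) (by omega)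
      split_ifs at a b <;> omega
    have hup : ∀ k, v + 1 + k ≤ n → L (v + 1 + k) = 0 := by
      intro k
      induction k with
      | zero => exact fun _ => hv'
      | succ k ih =>
        intro hk
        have ih := ih (by omega)
        have c := hstep (v + 1 + k) (by omega)
        rw [← Nat.add_assoc]
        omega
    have hdown : ∀ k, k ≤ v → L (v - k) = 0 := by
      intro k
      induction k with
      | zero => exact fun _ => hv
      | succ k ih =>
        intro hk
        have ih := ih (by omega)
        have a := hL (v - (k + 1)) (by omega)
        have c := hstep (v - (k + 1)) (by omega)
        rw [show v - (k + 1) + 1 = v - k by omega] at c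
        split_ifs at a <;> omega
    intro i hi
    rcases Nat.lt_or_ge v i with h | h
    · have := hup (i - v - 1) (by omega)
      rwa [show v + 1 + (i - v - 1) = i by omega] at this
    · have := hdown (v - i) (by omega)
      rwa [show v - (v - i) = i by omega] at this

theorem attach_adj_inl {V X : Type*} {S : Digraph V} {u : V} {H : Digraph X} {σ : ℕ → X} {ℓ : ℕ}
    {a b : V} (h : (attach S u H σ ℓ).Adj (Sum.inl a) (Sum.inl b)) : S.Adj a b := by
  rcases h with ⟨a', b', ha, hb, h⟩ | ⟨j, hj, ⟨-, h, -⟩ | ⟨h, -, -⟩⟩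
  · cases ha
    cases hb
    exact h
  · rw [pendant_succ u hj] at h
    cases h
  · rw [pendant_succ u hj] at h
    cases h

/-- Attaching a turning path over a vertex `v` far from both ends does not create a copy of the core
path. -/
theorem not_traces_attach_turn {V : Type u} {S : Digraph V} {w : ℕ → Bool} {n v : ℕ}
    (hcore : IsCoreWord w n) (h2 : 2 ≤ v) (hn : v + 2 ≤ n) (f : S.Adj →r (wordDigraph w).Adj)
    (hf : ∀ x, f x ≤ n) {u : V} (hu : f u = v) (hno : ¬ ∃ p, Traces S w 0 n p) (s : Bool) :
    ¬ ∃ p, Traces (attach S u (wordDigraph w) (turn s v) (turnLength s n v)) w 0 n p := by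
  rintro ⟨p, hp⟩
  have h0 : turn s v 0 = f u := by cases s <;> simp [turn, hu]
  have hle : ∀ x, attachProj (S := S) (ℓ := turnLength s n v) f h0 x ≤ n := by
    rintro (a | ⟨j, hj⟩)
    · exact hf a
    · change turn s v (j + 1) ≤ n
      revert hj
      cases s <;> simp only [turn, turnLength, Bool.false_eq_true, if_false, if_true] <;>
        split_ifs <;> omega
  obtain ⟨h, hh, hsec⟩ := hcore.exists_section (attachProj f h0) hle hp
  have hlev : ∀ i ≤ n, level (h i) = 0 := by
    refine level_eq_zero_of_section (s := s) h2 hn ?_ ?_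
    · intro i hi
      have := hsec i hi
      cases hx : h i with
      | inl a => exact Or.inl rfl
      | inr j =>
        rw [hx] at this
        exact Or.inr this.symm
    · intro i hi
      have harc := hh i (Nat.zero_le _) hi
      have hadj : (attach S u (wordDigraph w) (turn s v) (turnLength s n v)).Adj (h i) (h (i + 1)) ∨
          (attach S u (wordDigraph w) (turn s v) (turnLength s n v)).Adj (h (i + 1)) (h i) := by
        cases hw : w i <;> rw [hw] at harc
        · exact Or.inr harc
        · exact Or.inl harc
      have e1 := hsec i hi.le
      have e2 := hsec (i + 1) hi
      rcases attach_adj_cases hadj with ⟨a, b, ha, hb, -⟩ | ⟨j, hj, ⟨ha, hb⟩ | ⟨ha, hb⟩⟩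
      · rw [ha, hb]
        exact Or.inl ⟨rfl, rfl⟩
      · rw [ha] at e1 ⊢
        rw [hb] at e2 ⊢
        rw [level_pendant u hj.le, level_pendant u hj]
        refine Or.inr ⟨fun hj0 => ?_, fun h => by omega, Or.inl rfl⟩
        subst hj0
        exact e1.symm.trans hu
      · rw [ha] at e1 ⊢
        rw [hb] at e2 ⊢
        rw [level_pendant u hj.le, level_pendant u hj]
        refine Or.inr ⟨fun h => by omega, fun hj0 => ?_, Or.inr rfl⟩
        subst hj0
        exact e2.symm.trans hu
  have hinl : ∀ x : V ⊕ Fin (turnLength s n v), level x = 0 →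
      Sum.inl (Sum.elim id (fun _ => u) x) = x := by
    rintro (a | j) hx
    · rfl
    · exact absurd hx (Nat.succ_ne_zero _)
  -- The section stays in the base, so it is already an image of the core in `S`; the value `u` on
  -- pendant vertices is never taken.
  refine hno ⟨fun i => Sum.elim id (fun _ => u) (h i), fun i hi hi' => ?_⟩
  have harc := hh i hi hi'
  rw [← hinl _ (hlev i hi'.le), ← hinl _ (hlev (i + 1) hi')] at harc
  cases hw : w i <;> rw [hw] at harc
  · exact attach_adj_inl harc
  · exact attach_adj_inl harc

/-! ### Alternating zigzags force long paths in the target -/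

/-- The part of the path with word `w` and length `n` after `v` (if `s` is true) or before `v`
(otherwise) maps to `S` in such a way that `v` goes to `u`. -/
def HasSide {V : Type*} (w : ℕ → Bool) (n v : ℕ) (s : Bool) (S : Digraph V) (u : V) : Prop :=
  ∃ p, Traces S w (if s then v else 0) (if s then n else v) p ∧ p v = u

theorem HasSide.map {V W : Type*} {w : ℕ → Bool} {n v : ℕ} {s : Bool} {S : Digraph V}
    {D : Digraph W} {u : V} (h : HasSide w n v s S u) (g : S.Adj →r D.Adj) :
    HasSide w n v s D (g u) := by
  obtain ⟨p, hp, rfl⟩ := h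
  exact ⟨_, hp.map g, rfl⟩

theorem HasSide.exists_traces {V : Type*} {w : ℕ → Bool} {n v : ℕ} {s : Bool} {S : Digraph V}
    {u : V} (h : HasSide w n v s S u) (h' : HasSide w n v (!s) S u) : ∃ p, Traces S w 0 n p := by
  have key : HasSide w n v false S u → HasSide w n v true S u → ∃ p, Traces S w 0 n p := by
    rintro ⟨p, hp, hpu⟩ ⟨q, hq, hqu⟩
    refine ⟨fun i => if i < v then p i else q i, fun i _ hi => ?_⟩
    rcases Nat.lt_or_ge i v with hiv | hiv
    · have hpi := hp i (Nat.zero_le _) hiv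
      rcases Nat.lt_or_ge (i + 1) v with hiv' | hiv'
      · simpa only [hiv, hiv', if_true] using hpi
      · obtain rfl : i + 1 = v := by omega
        rw [hpu, ← hqu] at hpi
        simpa using hpi
    · have hqi := hq i hiv hi
      simpa only [show ¬ i < v by omega, show ¬ i + 1 < v by omega, if_false] using hqi
  cases s
  · exact key h h'
  · exact key h' h

/-- One zigzag: `t` and `u'` are its vertices 1 and 2, and the rest of the pendant path runs from
`u'` to the end on side `s`. -/
theorem exists_half_step {V : Type u} {S : Digraph V} {w : ℕ → Bool} {n v : ℕ}
    (hcore : IsCoreWord w n) (h2 : 2 ≤ v) (hn : v + 2 ≤ n) (hw : w (v - 1) = w v)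
    (hS : IsOrientedTree S) (f : S.Adj →r (wordDigraph w).Adj)
    (hf : ∀ x, f x ≤ n) {u : V} (hu : f u = v) (hno : ¬ ∃ p, Traces S w 0 n p) (s : Bool) :
    ∃ (V' : Type u) (S' : Digraph V') (f' : S'.Adj →r (wordDigraph w).Adj) (u' : V')
      (g : S.Adj →r S'.Adj), IsOrientedTree S' ∧ (∀ x, f' x ≤ n) ∧ f' u' = v ∧
      (¬ ∃ p, Traces S' w 0 n p) ∧ HasSide w n v s S' u' ∧
      ∃ t, Arc S' (w v == s) (g u) t ∧ Arc S' (w v == s) u' t := by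
  have h0 : turn s v 0 = f u := by cases s <;> simp [turn, hu]
  have hle : ∀ j ≤ turnLength s n v, turn s v j ≤ n := by
    intro j hj
    revert hj
    cases s <;> simp only [turn, turnLength, Bool.false_eq_true, if_false, if_true] <;>
      split_ifs <;> omega
  have hℓ : 2 < turnLength s n v := by
    cases s <;> simp [turnLength] <;> omega
  have hcons : ∀ j < turnLength s n v,
      turn s v (j + 1) = turn s v j + 1 ∨ turn s v j = turn s v (j + 1) + 1 := by
    intro j hj
    revert hj
    cases s <;> simp only [turn, turnLength, Bool.false_eq_true, if_false, if_true] <;>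
      split_ifs <;> omega
  have hproj : ∀ j ≤ turnLength s n v,
      attachProj (S := S) (ℓ := turnLength s n v) f h0 (pendant u _ j) = turn s v j :=
    fun j hj => proj_pendant h0 hj
  have hturn2 : turn s v 2 = v := by cases s <;> simp [turn]
  refine ⟨V ⊕ Fin (turnLength s n v), attach S u (wordDigraph w) (turn s v) (turnLength s n v),
    attachProj f h0, pendant u _ 2, attachInl,
    attach_isOrientedTree hS (wordDigraph_isOriented w) f h0
      fun j hj => wordDigraph_adj_or (hcons j hj), ?_, ?_,
    not_traces_attach_turn hcore h2 hn f hf hu hno s, ?_, pendant u _ 1, ?_, ?_⟩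
  · rintro (a | ⟨j, hj⟩)
    · exact hf a
    · exact hle (j + 1) hj
  · rw [hproj 2 hℓ.le, hturn2]
  · cases s
    · refine ⟨fun i => pendant u _ (v - i + 2), fun i _ hi => ?_, by simp⟩
      simp only [Bool.false_eq_true, if_false] at hi
      have e : v - i + 2 = v - (i + 1) + 2 + 1 := by omega
      beta_reduce
      rw [← arc_not_iff, e]
      refine attach_arc (by simp only [turnLength, Bool.false_eq_true, if_false]; omega) ?_
      rw [← e, arc_not_iff]
      have e1 : turn false v (v - i + 2) = i := by
        simp only [turn, Bool.false_eq_true, if_false]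
        split_ifs <;> omega
      have e2 : turn false v (v - (i + 1) + 2) = i + 1 := by
        simp only [turn, Bool.false_eq_true, if_false]
        split_ifs <;> omega
      rw [e1, e2]
      exact wordDigraph_arc w i
    · refine ⟨fun i => pendant u _ (i - v + 2), fun i hi hi' => ?_, by simp⟩
      simp only [if_true] at hi hi'
      have e : i + 1 - v + 2 = i - v + 2 + 1 := by omega
      beta_reduce
      rw [e]
      refine attach_arc (by simp only [turnLength, if_true]; omega) ?_
      rw [← e]
      have e1 : turn true v (i - v + 2) = i := by
        simp only [turn, if_true]
        split_ifs <;> omega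
      have e2 : turn true v (i + 1 - v + 2) = i + 1 := by
        simp only [turn, if_true]
        split_ifs <;> omega
      rw [e1, e2]
      exact wordDigraph_arc w i
  all_goals
    -- Straightness `hw` makes `w v == s` the direction of the first arc from `v` towards side `s`,
    -- for both values of `s`.
    have harc : Arc (wordDigraph w) (w v == s) v (turn s v 1) := by
      cases s
      · have := wordDigraph_arc w (v - 1)
        rw [hw, show v - 1 + 1 = v by omega, ← arc_not_iff] at this
        simpa [turn] using this
      · simpa [turn] using wordDigraph_arc w v
  · refine attach_arc (j := 0) (by omega) ?_
    rwa [h0, hu]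
  · rw [← arc_not_iff]
    refine attach_arc (j := 1) (by omega) ?_
    rwa [hturn2, arc_not_iff]

/-- There is a path of length at least `k` in `D` which ends at `y` and cannot be folded back along an
arc with direction `e` at `y`. -/
def EndsLongPath {V : Type*} (D : Digraph V) (e : Bool) (y : V) (k : ℕ) : Prop :=
  ∃ (a : V) (p : D.toSimpleGraphInclusive.Walk a y), p.IsPath ∧ k ≤ p.length ∧
    ∀ c, Arc D e y c → c ∉ p.support

/-- In a tree, a neighbour of the end of a path that lies on the path is the penultimate vertex.
Hence `y ≠ x` already keeps `y` off the path, and at `y` only an arc of direction `e` leads back, to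
`t`. -/
theorem EndsLongPath.extend {V : Type*} {D : Digraph V} (hD : IsOrientedTree D) {e : Bool} {x y t : V}
    {k : ℕ} (h : EndsLongPath D e x k) (hx : Arc D e x t) (hy : Arc D e y t) (hxy : x ≠ y) :
    EndsLongPath D (!e) y (k + 2) := by
  obtain ⟨-, hor, htree⟩ := hD
  obtain ⟨a, p, hp, hk, hc⟩ := h
  have hxt := hx.inclusive_adj hor
  have hty := (hy.inclusive_adj hor).symm
  have hp1 : (p.concat hxt).IsPath := hp.concat (hc t hx) hxt
  have hy1 : y ∉ (p.concat hxt).support := fun hmem => hxy <| by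
    rw [htree.isAcyclic.eq_penultimate_of_adj_end hp1 hty hmem, Walk.penultimate_concat]
  refine ⟨a, (p.concat hxt).concat hty, hp1.concat hy1 hty, ?_, fun c hyc hmem => ?_⟩
  · rw [Walk.length_concat, Walk.length_concat]
    omega
  · have := htree.isAcyclic.eq_penultimate_of_adj_end (hp1.concat hy1 hty)
      (hyc.inclusive_adj hor) hmem
    rw [Walk.penultimate_concat] at this
    subst this
    exact hor.not_arc hy (arc_not_iff.mp hyc)

/-- The direction `!(w v == s)` is that of the first arc towards the other side, where the next
zigzag goes; so the path in `D` can always be continued. -/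
theorem exists_growth {V : Type u} {S : Digraph V} {w : ℕ → Bool} {n v : ℕ}
    (hcore : IsCoreWord w n) (h2 : 2 ≤ v) (hn : v + 2 ≤ n) (hw : w (v - 1) = w v)
    (hS : IsOrientedTree S) (f : S.Adj →r (wordDigraph w).Adj)
    (hf : ∀ x, f x ≤ n) {u : V} (hu : f u = v) (hno : ¬ ∃ p, Traces S w 0 n p)
    {W : Type v} {D : Digraph W} (hD : IsOrientedTree D) (hnoD : ¬ ∃ p, Traces D w 0 n p) (k : ℕ) :
    ∃ (V' : Type u) (S' : Digraph V') (f' : S'.Adj →r (wordDigraph w).Adj) (u' : V') (s : Bool),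
      IsOrientedTree S' ∧ HomLE S S' ∧ (∀ x, f' x ≤ n) ∧ f' u' = v ∧
      (¬ ∃ p, Traces S' w 0 n p) ∧ HasSide w n v s S' u' ∧
      ∀ g : S'.Adj →r D.Adj, EndsLongPath D (!(w v == s)) (g u') k := by
  induction k with
  | zero =>
    obtain ⟨V', S', f', u', g, hS', hf', hu', hno', hside, -⟩ :=
      exists_half_step hcore h2 hn hw hS f hf hu hno true
    refine ⟨V', S', f', u', true, hS', ⟨g⟩, hf', hu', hno', hside, fun g => ?_⟩
    refine ⟨_, Walk.nil, Walk.IsPath.nil, le_rfl, fun c hc hmem => ?_⟩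
    rw [Walk.support_nil, List.mem_singleton] at hmem
    subst hmem
    exact hD.2.1.not_arc hc hc
  | succ k ih =>
    obtain ⟨V₁, S₁, f₁, u₁, s, hS₁, ⟨g₁⟩, hf₁, hu₁, hno₁, hside₁, hlong⟩ := ih
    obtain ⟨V', S', f', u', g', hS', hf', hu', hno', hside', t, ht, ht'⟩ :=
      exists_half_step hcore h2 hn hw hS₁ f₁ hf₁ hu₁ hno₁ (!s)
    refine ⟨V', S', f', u', !s, hS', ⟨g'.comp g₁⟩, hf', hu', hno', hside', fun g => ?_⟩
    -- If the images agreed, the two complementary halves would glue to an image of the core in `D`.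
    have hne : g (g' u₁) ≠ g u' := fun heq =>
      hnoD (HasSide.exists_traces (hside₁.map (g.comp g'))
        (show HasSide w n v (!s) D (g (g' u₁)) by rw [heq]; exact hside'.map g))
    have h1 : EndsLongPath D (w v == !s) (g (g' u₁)) k := by
      have := hlong (g.comp g')
      rwa [show (!(w v == s)) = (w v == !s) by cases w v <;> cases s <;> rfl] at this
    obtain ⟨a, p, hp, hk, hc⟩ := h1.extend hD (ht.map g) (ht'.map g) hne
    exact ⟨a, p, hp, by omega, hc⟩

/-- Above a tree which meets the fibre of `v`, but does not lie above the core path, there is another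
such tree that has no homomorphism to a given tree `D` not above the core path. -/
theorem exists_tree_not_homLE {V : Type u} {S : Digraph V} {w : ℕ → Bool} {n v : ℕ}
    (hcore : IsCoreWord w n) (h2 : 2 ≤ v) (hn : v + 2 ≤ n) (hw : w (v - 1) = w v)
    (hS : IsOrientedTree S) (f : S.Adj →r (wordDigraph w).Adj)
    (hf : ∀ x, f x ≤ n) {u : V} (hu : f u = v) (hno : ¬ ∃ p, Traces S w 0 n p)
    {W : Type v} {D : Digraph W} (hD : IsOrientedTree D) (hnoD : ¬ ∃ p, Traces D w 0 n p) :
    ∃ (V' : Type u) (S' : Digraph V') (f' : S'.Adj →r (wordDigraph w).Adj),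
      IsOrientedTree S' ∧ HomLE S S' ∧ (∀ x, f' x ≤ n) ∧ (¬ ∃ p, Traces S' w 0 n p) ∧
      ¬ HomLE S' D := by
  have := hD.1
  have := Fintype.ofFinite W
  -- A path in `D` is shorter than the number of vertices, so this length is out of reach.
  obtain ⟨V', S', f', u', s, hS', hSS', hf', -, hno', -, hlong⟩ :=
    exists_growth hcore h2 hn hw hS f hf hu hno hD hnoD (Fintype.card W)
  refine ⟨V', S', f', hS', hSS', hf', hno', ?_⟩
  rintro ⟨g⟩
  obtain ⟨a, p, hp, hk, -⟩ := hlong g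
  exact absurd hp.length_lt (by omega)

/-! ### Reduction of an oriented path to a core word -/

theorem Traces.homLE {V W : Type*} {G : Digraph V} {H : Digraph W} {w : ℕ → Bool} {n : ℕ}
    {p : ℕ → V} (hp : Traces G w 0 n p) (f : H.Adj →r (wordDigraph w).Adj) (hf : ∀ x, f x ≤ n) :
    HomLE H G :=
  ⟨⟨fun x => p (f x), fun h => hp.adj (hf _) (hf _) (f.map_rel h)⟩⟩

theorem IsOrientedPath.exists_word {W : Type*} {P : Digraph W} (hP : IsOrientedPath P) :
    ∃ (n : ℕ) (w : ℕ → Bool), (∃ p, Traces P w 0 n p) ∧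
      ∃ f : P.Adj →r (wordDigraph w).Adj, ∀ x, f x ≤ n := by
  classical
  obtain ⟨hor, n, ⟨φ⟩⟩ := hP
  let p : ℕ → W := fun i => φ ⟨min i n, by omega⟩
  have hpφ : ∀ x, p (φ.symm x) = x := fun x => by
    have : (⟨min (φ.symm x : ℕ) n, by omega⟩ : Fin (n + 1)) = φ.symm x := by
      apply Fin.ext
      have := (φ.symm x).2
      change min (φ.symm x : ℕ) n = φ.symm x
      omega
    change φ _ = x
    rw [this, RelIso.apply_symm_apply]
  refine ⟨n, fun i => decide (P.Adj (p i) (p (i + 1))), ⟨p, fun i _ hi => ?_⟩,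
    ⟨fun x => φ.symm x, ?_⟩, fun x => Nat.le_of_lt_succ (φ.symm x).2⟩
  · have hadj : P.toSimpleGraphInclusive.Adj (p i) (p (i + 1)) := by
      refine φ.map_rel_iff.mpr ?_
      rw [pathGraph_adj]
      left
      change min i n + 1 = min (i + 1) n
      omega
    rw [hor.inclusive_adj] at hadj
    by_cases h : P.Adj (p i) (p (i + 1))
    · simp [Arc, h]
    · simpa [Arc, h] using hadj
  · intro x y hxy
    have hadj := φ.symm.map_rel_iff.mpr (hor.inclusive_adj.mpr (Or.inl hxy))
    rw [pathGraph_adj] at hadj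
    rcases hadj with h | h
    · refine Or.inl ⟨h.symm, ?_⟩
      rw [decide_eq_true_eq, h, hpφ, hpφ]
      exact hxy
    · refine Or.inr ⟨h.symm, ?_⟩
      rw [decide_eq_false_iff_not, h, hpφ, hpφ]
      exact hor _ _ hxy

theorem traces_ne_side {w w' : ℕ → Bool} {n j : ℕ} {φ : ℕ → ℕ}
    (hφ : Traces (wordDigraph w') w 0 n φ) (hj : ∀ i ≤ n, φ i ≠ j) :
    (∀ i ≤ n, φ i < j) ∨ ∀ i ≤ n, j < φ i := by
  rcases Nat.lt_or_gt_of_ne (hj 0 (Nat.zero_le _)) with h | h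
  · left
    intro i
    induction i with
    | zero => exact fun _ => h
    | succ i ih =>
      intro hi
      have a := ih (by omega)
      have b := (hφ i (Nat.zero_le _) hi).wordDigraph_consecutive
      have c := hj (i + 1) hi
      omega
  · right
    intro i
    induction i with
    | zero => exact fun _ => h
    | succ i ih =>
      intro hi
      have a := ih (by omega)
      have b := (hφ i (Nat.zero_le _) hi).wordDigraph_consecutive
      have c := hj (i + 1) hi
      omega

/-- Take a shortest word equivalent to `P`. The image of an endomorphism missing `j` lies on one
side of `j`, and that proper segment would be a shorter equivalent word. -/
theorem IsOrientedPath.exists_core {W : Type*} {P : Digraph W} (hP : IsOrientedPath P) :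
    ∃ (n : ℕ) (w : ℕ → Bool), IsCoreWord w n ∧ (∃ p, Traces P w 0 n p) ∧
      ∃ f : P.Adj →r (wordDigraph w).Adj, ∀ x, f x ≤ n := by
  classical
  have hex := hP.exists_word
  obtain ⟨w, ⟨p, hp⟩, f, hf⟩ := Nat.find_spec hex
  have hmin : ∀ m, m < Nat.find hex → _ := fun m hm => Nat.find_min hex hm
  set n := Nat.find hex
  refine ⟨n, w, fun φ hle hφ j hj => ?_, ⟨p, hp⟩, f, hf⟩
  by_contra hcon
  push Not at hcon
  rcases traces_ne_side hφ hcon with h | h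
  · have h0 := h 0 (Nat.zero_le _)
    refine hmin (j - 1) (by omega) ⟨w, ⟨p, fun i hi hi' => hp i hi (by omega)⟩,
      ⟨fun x => φ (f x), fun hxy => hφ.adj (hf _) (hf _) (f.map_rel hxy)⟩, fun x => ?_⟩
    have := h (f x) (hf x)
    change φ (f x) ≤ j - 1
    omega
  · have h0 := h 0 (Nat.zero_le _)
    have h0' := hle 0 (Nat.zero_le _)
    refine hmin (n - (j + 1)) (by omega) ⟨fun i => w (i + (j + 1)),
      ⟨fun i => p (i + (j + 1)), fun i hi hi' => ?_⟩,
      ⟨fun x => φ (f x) - (j + 1), fun {x y} hxy => ?_⟩, fun x => ?_⟩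
    · have := hp (i + (j + 1)) (Nat.zero_le _) (by omega)
      rwa [show i + (j + 1) + 1 = i + 1 + (j + 1) by omega] at this
    · have hx := h (f x) (hf x)
      have hy := h (f y) (hf y)
      rcases hφ.adj (hf _) (hf _) (f.map_rel hxy) with ⟨k, k'⟩ | ⟨k, k'⟩
      · refine Or.inl ⟨by omega, ?_⟩
        beta_reduce
        rwa [show φ (f x) - (j + 1) + (j + 1) = φ (f x) by omega]
      · refine Or.inr ⟨by omega, ?_⟩
        beta_reduce
        rwa [show φ (f y) - (j + 1) + (j + 1) = φ (f y) by omega]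
    · have := hle (f x) (hf x)
      change φ (f x) - (j + 1) ≤ n - (j + 1)
      omega

/-! ### Height and straight vertices -/

/-- An oriented path without two consecutive equally oriented edges, except possibly at its ends, has
height at most three. -/
theorem traces_directedPath_three {w : ℕ → Bool} {n : ℕ}
    (halt : ∀ i, 2 ≤ i → i + 2 ≤ n → w (i - 1) ≠ w i) :
    ∃ p, Traces (directedPath 3) w 0 n p := by
  -- Interior vertices alternate between levels 1 and 2; only the two end vertices may reach 0 or 3.
  -- For `3 ≤ i ≤ n`, equality of `w (i - 2)` and `w (i - 1)` forces `i = n`.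
  let lev : ℕ → ℕ := fun i =>
    if i = 0 then (if w 1 then (if w 0 then 0 else 2) else (if w 0 then 1 else 3))
    else if i = 1 then (if w 1 then 1 else 2)
    else if 3 ≤ i ∧ w (i - 2) = w (i - 1) then (if w (i - 1) then 3 else 0)
    else (if w (i - 1) then 2 else 1)
  have hlev : ∀ i, lev i < 4 := by
    intro i
    simp only [lev]
    split_ifs <;> omega
  refine ⟨fun i => ⟨lev i, hlev i⟩, fun i _ hi => ?_⟩
  have key : if w i then lev i + 1 = lev (i + 1) else lev (i + 1) + 1 = lev i := by
    match i, hi with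
    | 0, _ => cases h0 : w 0 <;> cases h1 : w 1 <;> simp [lev, h0, h1]
    | 1, _ => cases h1 : w 1 <;> simp [lev, h1]
    | 2, _ => cases h1 : w 1 <;> cases h2 : w 2 <;> simp [lev, h1, h2]
    | k + 3, hk =>
      have hne : w (k + 1) ≠ w (k + 2) := halt (k + 2) (by omega) (by omega)
      cases h1 : w (k + 1) <;> cases h2 : w (k + 2) <;> cases h3 : w (k + 3) <;>
        simp [lev, h1, h2, h3] at hne ⊢
  cases hw : w i <;> rw [hw] at key
  · exact key
  · exact key

theorem exists_straight_vertex {W : Type*} {P : Digraph W} (hheight : 4 ≤ height P) {n : ℕ}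
    {w : ℕ → Bool} (f : P.Adj →r (wordDigraph w).Adj) (hf : ∀ x, f x ≤ n) :
    ∃ v, 2 ≤ v ∧ v + 2 ≤ n ∧ w (v - 1) = w v := by
  by_contra hcon
  push Not at hcon
  obtain ⟨p, hp⟩ := traces_directedPath_three hcon
  have : height P ≤ 3 := Nat.sInf_le (hp.homLE f hf)
  omega

/-! ### Reaching the fibre, and the final assembly -/

theorem HomLE.trans {U V W : Type*} {F : Digraph U} {G : Digraph V} {H : Digraph W}
    (h : HomLE F G) (h' : HomLE G H) : HomLE F H := by
  obtain ⟨f⟩ := h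
  obtain ⟨g⟩ := h'
  exact ⟨g.comp f⟩

/-- A tree over a core path which is not above the path can be extended to one that meets the fibre
of an interior vertex `v`. -/
theorem exists_tree_meeting_fibre {V : Type u} {S : Digraph V} {w : ℕ → Bool} {n v : ℕ}
    (hcore : IsCoreWord w n) (h1 : 0 < v) (hn : v < n) (hS : IsOrientedTree S)
    (f : S.Adj →r (wordDigraph w).Adj) (hf : ∀ x, f x ≤ n) (hno : ¬ ∃ p, Traces S w 0 n p) :
    ∃ (V' : Type u) (S' : Digraph V') (f' : S'.Adj →r (wordDigraph w).Adj) (u' : V'),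
      IsOrientedTree S' ∧ HomLE S S' ∧ (∀ x, f' x ≤ n) ∧ f' u' = v ∧
      ¬ ∃ p, Traces S' w 0 n p := by
  by_cases hmeet : ∃ a, f a = v
  · obtain ⟨a, ha⟩ := hmeet
    exact ⟨V, S, f, a, hS, ⟨RelHom.id _⟩, hf, ha, hno⟩
  push Not at hmeet
  obtain ⟨a⟩ := hS.2.2.connected.nonempty
  have hcons : ∀ x y, S.toSimpleGraphInclusive.Adj x y → f y = f x + 1 ∨ f x = f y + 1 := by
    intro x y hxy
    rw [hS.2.1.inclusive_adj] at hxy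
    rcases hxy with hxy | hxy
    · exact Arc.wordDigraph_consecutive (d := true) (f.map_rel hxy)
    · exact Arc.wordDigraph_consecutive (d := false) (f.map_rel hxy)
  rcases Nat.lt_or_gt_of_ne (hmeet a) with hav | hav
  · have hlow : ∀ x, f x < v := fun x =>
      reachable_invariant (C := fun x => f x < v) (fun x y hxy hx => by
        have := hcons x y hxy
        have := hmeet y
        omega) (hS.2.2.connected.preconnected a x) hav
    have h0 : (fun j => f a + j) 0 = f a := rfl
    have hle : ∀ x, attachProj (S := S) (u := a) (ℓ := v - f a) f h0 x ≤ v := by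
      rintro (x | ⟨j, hj⟩)
      · exact (hlow x).le
      · change f a + (j + 1) ≤ v
        omega
    refine ⟨_, attach S a (wordDigraph w) (fun j => f a + j) (v - f a), attachProj f h0,
      pendant a _ (v - f a), attach_isOrientedTree hS (wordDigraph_isOriented w) f h0
        fun j hj => wordDigraph_adj_or (Or.inl rfl), ⟨attachInl⟩,
      fun x => (hle x).trans hn.le, ?_, ?_⟩
    · refine (proj_pendant h0 le_rfl).trans ?_
      omega
    -- The tree projects into `[0, v]`, so the endomorphism induced by `p` would miss `n`; in the
    -- other case it misses `0`.
    · rintro ⟨p, hp⟩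
      obtain ⟨i, hi, hin⟩ := hcore _ (fun i _ => (hle (p i)).trans hn.le)
        (hp.map (attachProj f h0)) n le_rfl
      have := hle (p i)
      omega
  · have hhigh : ∀ x, v < f x := fun x =>
      reachable_invariant (C := fun x => v < f x) (fun x y hxy hx => by
        have := hcons x y hxy
        have := hmeet y
        omega) (hS.2.2.connected.preconnected a x) hav
    have h0 : (fun j => f a - j) 0 = f a := rfl
    have hle : ∀ x, v ≤ attachProj (S := S) (u := a) (ℓ := f a - v) f h0 x ∧
        attachProj (S := S) (u := a) (ℓ := f a - v) f h0 x ≤ n := by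
      have hfa := hf a
      rintro (x | ⟨j, hj⟩)
      · exact ⟨(hhigh x).le, hf x⟩
      · change v ≤ f a - (j + 1) ∧ f a - (j + 1) ≤ n
        omega
    refine ⟨_, attach S a (wordDigraph w) (fun j => f a - j) (f a - v), attachProj f h0,
      pendant a _ (f a - v), attach_isOrientedTree hS (wordDigraph_isOriented w) f h0
        fun j hj => wordDigraph_adj_or (Or.inr (by omega)), ⟨attachInl⟩,
      fun x => (hle x).2, ?_, ?_⟩
    · refine (proj_pendant h0 le_rfl).trans ?_
      omega
    · rintro ⟨p, hp⟩
      obtain ⟨i, hi, hin⟩ := hcore _ (fun i _ => (hle (p i)).2)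
        (hp.map (attachProj f h0)) 0 (Nat.zero_le _)
      have := (hle (p i)).1
      omega

/-- Attaching changes the vertex type, while the final tree has to live on some `Fin n`. -/
theorem IsOrientedTree.exists_fin {V : Type*} {S : Digraph V} (hS : IsOrientedTree S) :
    ∃ (n : ℕ) (T : Digraph (Fin n)), IsOrientedTree T ∧ HomLE S T ∧ HomLE T S := by
  obtain ⟨hfin, hor, htree⟩ := hS
  obtain ⟨n, ⟨e⟩⟩ := Finite.exists_equiv_fin V
  let T : Digraph (Fin n) := ⟨fun i j => S.Adj (e.symm i) (e.symm j)⟩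
  have hT : IsOriented T := fun i j => hor _ _
  refine ⟨n, T, ⟨inferInstance, hT, ?_⟩, ⟨⟨e, fun {x y} h => ?_⟩⟩, ⟨⟨e.symm, id⟩⟩⟩
  · let φ : T.toSimpleGraphInclusive ≃g S.toSimpleGraphInclusive :=
      ⟨e.symm, fun {i j} => by rw [hor.inclusive_adj, hT.inclusive_adj]⟩
    exact φ.isTree_iff.mpr htree
  · change S.Adj (e.symm (e x)) (e.symm (e y))
    simpa using h

end OrientedTrees

theorem theorem5 {V W : Type*} (T₁ : Digraph V) (P₂ : Digraph W)
    (hT₁ : OrientedTrees.IsOrientedTree T₁) (hP₂ : OrientedTrees.IsOrientedPath P₂)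
    (hlt : OrientedTrees.HomLT T₁ P₂) (hheight : 4 ≤ OrientedTrees.height P₂) :
    ∃ (n : ℕ) (T : Digraph (Fin n)), OrientedTrees.IsOrientedTree T ∧
      OrientedTrees.HomLT T₁ T ∧ OrientedTrees.HomLT T P₂ := by
  obtain ⟨n, w, hcore, ⟨p, hp⟩, f, hf⟩ := hP₂.exists_core
  obtain ⟨v, h2, hn, hw⟩ := OrientedTrees.exists_straight_vertex hheight f hf
  obtain ⟨⟨g⟩, hnot⟩ := hlt
  have hno : ¬ ∃ q, OrientedTrees.Traces T₁ w 0 n q := fun ⟨q, hq⟩ => hnot (hq.homLE f hf)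
  obtain ⟨V₁, S₁, f₁, u₁, hS₁, hTS₁, hf₁, hu₁, hno₁⟩ :=
    OrientedTrees.exists_tree_meeting_fibre hcore (v := v) (by omega) (by omega) hT₁ (f.comp g)
      (fun x => hf (g x)) hno
  -- The target to be avoided is `T₁` itself, which by `hno` contains no image of the core.
  obtain ⟨V₂, S₂, f₂, hS₂, hSS, hf₂, hno₂, hnot₂⟩ :=
    OrientedTrees.exists_tree_not_homLE hcore h2 hn hw hS₁ f₁ hf₁ hu₁ hno₁ hT₁ hno
  obtain ⟨m, T, hT, hST, hTS⟩ := hS₂.exists_fin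
  refine ⟨m, T, hT, ⟨(hTS₁.trans hSS).trans hST, fun h => hnot₂ (hST.trans h)⟩,
    hTS.trans (hp.homLE f₂ hf₂), fun h => ?_⟩
  obtain ⟨k⟩ := h.trans hTS
  exact hno₂ ⟨_, hp.map k⟩
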